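/- **Setting.** Let $(D,\mathcal M,\mu)$ be a measure space with $\mu(D)<\infty$, let $p\in(1,\infty)$, $\frac1p+\frac1{p'}=1$, $X=L^p(D,\mathcal M,\mu)$, $X^*=L^{p'}(D,\mathcal M,\mu)$, $\langle f,v\rangle=\int_D f v\,d\mu$ for $f\in X^*$, $v\in X$, and $K_+=\{v\in X: v\ge 0\}$. Let $(\Omega,\mathcal F,(\mathcal F_t)_{t\ge 0},\mathsf P)$ be a filtered probability space. Let $\mathcal A:\mathcal D(\mathcal A)\subseteq X\to X$ be a closed, densely defined linear operator that generates a $C_0$-semigroup $(e^{t\mathcal A})_{t\ge0}$ of positivity-preserving bounded operators on $X$, and suppose that the constant function $\mathbf 1$ is an eigenvector of $\mathcal A$ and of $\mathcal A^*$, with eigenvalues $\lambda_0,\lambda_0^*\in\mathbb R$ respectively. Let $r>\lambda_0^*\vee 0$ and $\alpha\in(0,1)$, let $z^*=(z^*_t)_{t\ge0}$ and $\varphi^*=(\varphi^*_t)_{t\ge0}$ be nonnegative, progressively measurable real-valued processes, $\varphi^*$ with càdlàg paths, and set $$\Pi(\omega,t,\mathbf k)=\tfrac1{1-\alpha}\,(z^*_t(\omega))^\alpha\,\langle\mathbf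 1,\mathbf k^{1-\alpha}\rangle\quad(\mathbf k\in K_+),\qquad \Phi^*_t(\omega)=e^{-rt}\varphi^*_t(\omega)\,\mathbf 1 .$$ (Path properties are understood $\mathsf P$-almost surely.) **Control problem.** Let $\mathcal S$ be the set of adapted processes $\nu:\Omega\times[0,\infty)\to K_+$ with nondecreasing, right-continuous paths; put $\nu_{0^-}=0$, so that $d\nu$ has an atom of size $\nu_0$ at time $0$. Let $\mathcal C$ be the set of those $\nu\in\mathcal S$ such that, almost surely, $d\nu=\rho\,d|\nu|$, where the variation measure $|\nu|$ is finite on bounded intervals and $\rho:[0,\infty)\to K_+$ is Bochner measurable and locally $|\nu|$-integrable, and such that $\mathsf E\big[\int_0^\infty\langle\Phi^*_t,d\nu_t\rangle\big]<\infty$, where $\int_0^\infty\langle\Phi^*_t,d\nu_t\rangle:=\int_{[0,\infty)}\langle\Phi^*_t,\rho_t\rangle\,d|\nu|_t$. For $\mathbf y\in K_+$ and $\nu\in\mathcal C$ let $$Y^{\mathbf y,\nu}_t=e^{t\mathcal A}\mathbf y+\int_{[0,t]}e^{(t-s)\mathcal A}\rho_s\,d|\nu|_s ,\qquad \mathcal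 J(\mathbf y,\nu)=\mathsf E\Big[\int_0^\infty \Pi\big(t,Y^{\mathbf y,\nu}_t\big)e^{-rt}\,dt-\int_0^\infty\langle\Phi^*_t,d\nu_t\rangle\Big]\in(-\infty,\infty],$$ and let $v(\mathbf y)=\sup_{\nu\in\mathcal C}\mathcal J(\mathbf y,\nu)$. **Lemma.** Suppose that $$\mathsf E\Big[\int_0^\infty e^{-(r\wedge(r-\lambda_0^*))t}(z^*_t)^\alpha\,dt\Big]<\infty$$ and that there is $m>0$ such that, for all $s\ge0$, almost surely, $$\mathsf E\Big[\int_s^\infty e^{-(r-\lambda_0^*)t}(z^*_t)^\alpha\,dt\,\Big|\,\mathcal F_s\Big]\le m\,e^{-(r-\lambda_0^*)s}\varphi^*_s .$$ Then there is a constant $C>0$, independent of $\mathbf y$, such that $v(\mathbf y)\le C\,(1+\langle\mathbf 1,\mathbf y\rangle)$ for all $\mathbf y\in K_+$. -/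

import Mathlib

open MeasureTheory ProbabilityTheory Filter Topology
open scoped NNReal ENNReal

noncomputable section

namespace SingularControl

/-! ### Semigroups and their generators -/

section Semigroup

variable {X : Type*} [NormedAddCommGroup X] [NormedSpace ℝ X]

/-- A `C₀`-semigroup of bounded linear operators on `X`. -/
structure IsC0Semigroup (S : ℝ≥0 → X →L[ℝ] X) : Prop where
  map_zero : S 0 = ContinuousLinearMap.id ℝ X
  map_add : ∀ s t, S (s + t) = (S s).comp (S t)
  continuous_orbit : ∀ f, Continuous fun t => S t f

/-- The (unbounded) operator `A` is the generator of `S`: a pair `(f, g)` is in the graph of `A`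
if and only if `(S h f - f) / h → g` as `h ↓ 0`. -/
def IsGenerator (A : X →ₗ.[ℝ] X) (S : ℝ≥0 → X →L[ℝ] X) : Prop :=
  ∀ f g, (f, g) ∈ A.graph ↔
    Tendsto (fun h : ℝ≥0 => (h : ℝ)⁻¹ • (S h f - f)) (𝓝[>] 0) (𝓝 g)

/-- Every `S t` preserves positivity. -/
def IsPositivityPreserving [PartialOrder X] (S : ℝ≥0 → X →L[ℝ] X) : Prop :=
  ∀ t f, 0 ≤ f → 0 ≤ S t f

end Semigroup

/-! ### Integration with respect to a nondecreasing path -/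

section Path

variable {X : Type*} [NormedAddCommGroup X] [NormedSpace ℝ X] [PartialOrder X]

/-- The polar decomposition `dn = ρ d|n|` of the `X`-valued measure on `[0, ∞)` that is associated
with a path `n`, with the convention `n (0-) = 0` (an atom of size `n 0` at time `0`).
Here `m = |n|` is the variation measure of `n`, which is finite on bounded intervals, and the
density `ρ` is Bochner measurable with values in the positive cone. -/
structure IsPolarDecomposition (n : ℝ≥0 → X) (m : Measure ℝ≥0) (ρ : ℝ≥0 → X) : Prop where
  lt_top : ∀ t, m (Set.Iic t) < ∞
  variation : ∀ t, m (Set.Iic t) = ‖n 0‖ₑ + eVariationOn n (Set.Iic t)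
  stronglyMeasurable : StronglyMeasurable ρ
  nonneg : ∀ s, 0 ≤ ρ s
  integrableOn : ∀ t, IntegrableOn ρ (Set.Iic t) m
  eq_integral : ∀ t, n t = ∫ s in Set.Iic t, ρ s ∂m

/-- The path `n` has a polar decomposition, so that integrals with respect to `dn` make sense. -/
def HasPolarDecomposition (n : ℝ≥0 → X) : Prop :=
  ∃ (m : Measure ℝ≥0) (ρ : ℝ≥0 → X), IsPolarDecomposition n m ρ

open Classical in
/-- The variation measure `|n|` of a path with a polar decomposition (which determines it
uniquely). -/
def variationMeasure (n : ℝ≥0 → X) : Measure ℝ≥0 :=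
  if h : HasPolarDecomposition n then h.choose else 0

open Classical in
/-- The density `ρ` in `dn = ρ d|n|` (determined up to `|n|`-null sets). -/
def polarDensity (n : ℝ≥0 → X) : ℝ≥0 → X :=
  if h : HasPolarDecomposition n then h.choose_spec.choose else 0

/-- The chosen pair is a polar decomposition whenever there is one. -/
theorem isPolarDecomposition_of_hasPolarDecomposition {n : ℝ≥0 → X}
    (h : HasPolarDecomposition n) :
    IsPolarDecomposition n (variationMeasure n) (polarDensity n) := by
  simp only [variationMeasure, polarDensity, dif_pos h]
  exact h.choose_spec.choose_spec

/-- The mild solution `Y_t = S_t y + ∫_{[0,t]} S_{t-s} dn_s` of `dY = A Y dt + dn`, `Y_{0-} = y`. -/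
def mildSolution (S : ℝ≥0 → X →L[ℝ] X) (y : X) (n : ℝ≥0 → X) (t : ℝ≥0) : X :=
  S t y + ∫ s in Set.Iic t, S (t - s) (polarDensity n s) ∂(variationMeasure n)

end Path

/-! ### The control problem on `X = L^p(D, μ)`, `X* = L^{p'}(D, μ)` -/

section Problem

variable {D : Type*} [MeasurableSpace D] {μ : Measure D} {p p' : ℝ≥0∞}

/-- The duality pairing `⟨f, v⟩` of `f ∈ X* = L^{p'}` and `v ∈ X = L^p`. -/
def pairing (f : Lp ℝ p' μ) (v : Lp ℝ p μ) : ℝ :=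
  ∫ x, f x * v x ∂μ

/-- The cost integral `∫_0^∞ ⟨f_t, dn_t⟩ = ∫_{[0,∞)} ⟨f_t, ρ_t⟩ d|n|_t ∈ [0, ∞]` of a
nonnegative `f` along a path `n`. -/
def costIntegral [Fact (1 ≤ p)] (f : ℝ≥0 → Lp ℝ p' μ) (n : ℝ≥0 → Lp ℝ p μ) : ℝ≥0∞ :=
  ∫⁻ t, ENNReal.ofReal (pairing (f t) (polarDensity n t)) ∂(variationMeasure n)

/-- `(g, h)` is in the graph of the adjoint `A*` of the densely defined operator `A`:
`⟨g, A f⟩ = ⟨h, f⟩` for all `f` in the domain of `A`. -/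
def IsAdjointPair (A : Lp ℝ p μ →ₗ.[ℝ] Lp ℝ p μ) (g h : Lp ℝ p' μ) : Prop :=
  ∀ f : A.domain, pairing g (A f) = pairing h (f : Lp ℝ p μ)

variable {Ω : Type*} {mΩ : MeasurableSpace Ω}

/-- The set `𝒮`: adapted processes whose paths are almost surely `K₊`-valued, nondecreasing and
right-continuous. -/
structure IsControl [Fact (1 ≤ p)] (P : Measure Ω) (ℱ : Filtration ℝ≥0 mΩ)
    (ν : ℝ≥0 → Ω → Lp ℝ p μ) : Prop where
  adapted : StronglyAdapted ℱ ν
  nonneg : ∀ᵐ ω ∂P, ∀ t, 0 ≤ ν t ω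
  monotone : ∀ᵐ ω ∂P, Monotone fun t => ν t ω
  rightContinuous : ∀ᵐ ω ∂P, ∀ t, ContinuousWithinAt (fun u => ν u ω) (Set.Ici t) t

/-- The set `𝒞` of admissible controls: those elements of `𝒮` for which the integrals with respect
to `dν` are defined and whose expected cost is finite. -/
structure IsAdmissible [Fact (1 ≤ p)] (P : Measure Ω) (ℱ : Filtration ℝ≥0 mΩ)
    (Φ : ℝ≥0 → Ω → Lp ℝ p' μ) (ν : ℝ≥0 → Ω → Lp ℝ p μ) : Prop where
  isControl : IsControl P ℱ ν
  hasPolarDecomposition : ∀ᵐ ω ∂P, HasPolarDecomposition fun t => ν t ω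
  cost_lt_top : ∫⁻ ω, costIntegral (fun t => Φ t ω) (fun t => ν t ω) ∂P < ∞

/-- The performance criterion `E[∫ Π(t, Y_t) q(dt) - ∫ ⟨Φ_t, dν_t⟩]`. The profit `Π` is
nonnegative and the expected cost of an admissible control is finite, so this is a well-defined
element of `(-∞, ∞]`. -/
def performance [Fact (1 ≤ p)] (P : Measure Ω) (S : ℝ≥0 → Lp ℝ p μ →L[ℝ] Lp ℝ p μ)
    (q : Measure ℝ≥0) (profit : ℝ≥0 → Ω → Lp ℝ p μ → ℝ) (Φ : ℝ≥0 → Ω → Lp ℝ p' μ)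
    (y : Lp ℝ p μ) (ν : ℝ≥0 → Ω → Lp ℝ p μ) : EReal :=
  ((∫⁻ ω, ∫⁻ t, ENNReal.ofReal (profit t ω (mildSolution S y (fun u => ν u ω) t)) ∂q ∂P : ℝ≥0∞) :
      EReal) -
    ((∫⁻ ω, costIntegral (fun t => Φ t ω) (fun t => ν t ω) ∂P : ℝ≥0∞) : EReal)

/-- The value function: the supremum of the performance criterion over all admissible controls. -/
def valueFunction [Fact (1 ≤ p)] (P : Measure Ω) (ℱ : Filtration ℝ≥0 mΩ)
    (S : ℝ≥0 → Lp ℝ p μ →L[ℝ] Lp ℝ p μ) (q : Measure ℝ≥0)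
    (profit : ℝ≥0 → Ω → Lp ℝ p μ → ℝ) (Φ : ℝ≥0 → Ω → Lp ℝ p' μ) (y : Lp ℝ p μ) : EReal :=
  ⨆ (ν : ℝ≥0 → Ω → Lp ℝ p μ) (_ : IsAdmissible P ℱ Φ ν), performance P S q profit Φ y ν

/-! ### The separable specification -/

/-- Lebesgue measure on `[0, ∞)`. -/
def lebesgue : Measure ℝ≥0 :=
  (volume : Measure ℝ).comap ((↑) : ℝ≥0 → ℝ)

/-- The measure `q(dt) = e^{-rt} dt` on `[0, ∞)`. -/
def discountMeasure (r : ℝ) : Measure ℝ≥0 :=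
  lebesgue.withDensity fun t => ENNReal.ofReal (Real.exp (-r * t))

/-- The profit `Π(ω, t, k) = (1 - α)⁻¹ (z_t(ω))^α ⟨1, k^{1-α}⟩`. -/
def powerProfit (α : ℝ) (z : ℝ≥0 → Ω → ℝ) (t : ℝ≥0) (ω : Ω) (k : Lp ℝ p μ) : ℝ :=
  (1 - α)⁻¹ * z t ω ^ α * ∫ x, k x ^ (1 - α) ∂μ

/-- The space-homogeneous marginal cost `Φ_t(ω) = e^{-rt} φ_t(ω) 1 ∈ L^{p'}`. -/
def homogeneousCost (p' : ℝ≥0∞) (μ : Measure D) [IsFiniteMeasure μ] (r : ℝ)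
    (φ : ℝ≥0 → Ω → ℝ) (t : ℝ≥0) (ω : Ω) : Lp ℝ p' μ :=
  (Real.exp (-r * t) * φ t ω) • Lp.const p' μ (1 : ℝ)

/-- Right-continuous with left limits. -/
def IsCadlag (f : ℝ≥0 → ℝ) : Prop :=
  ∀ t, ContinuousWithinAt f (Set.Ici t) t ∧ ∃ l, Tendsto f (𝓝[<] t) (𝓝 l)

end Problem

end SingularControl

end

/-! Write `λ` for `eigAdj`, `N = ⟨1, ν⟩` for the total mass of a control, and `Y` for its mild
solution. Profit is sublinear in `Y` while cost is linear in `N`, so profit can be paid for by cost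
up to a constant. For each `ε > 0` there is `C` with `x ^ (1 - α) ≤ ε x + C`, so it suffices to
control `⟨1, Y⟩`. As `1` is an eigenvector of the adjoint, `⟨1, Y_t⟩ = e^{λt}⟨1, y⟩ + ∫_{[0,t]}
e^{λ(t-s)} dN_s`, of which only `≤` is needed. After Tonelli, the expected profit is at most a
constant times `1 + ⟨1, y⟩` plus `(1 - α)⁻¹ ε E ∫ ζ dN`, where `ζ_s = e^{-λs} ∫_s^∞ e^{-(r-λ)t}
z_t^α dt`. The hypothesis on conditional expectations bounds `ζ_s` in conditional mean by `ψ_s = m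
e^{-rs} φ_s`. With `ε = (1 - α) / m` the last term is then at most the expected cost, and cancels.

The delicate point is `E ∫ ζ dN ≤ E ∫ ψ dN` (`lintegral_lintegral_le`), since the domination is
given only at deterministic times and `ζ` is not adapted. A change of time turns `dN` into Lebesgue
measure on levels `u`, evaluated at the stopping times `T_u = inf {s | u ≤ N_s}`. At stopping times
the domination follows by approximation from the right along grids (`lintegral_stopped_le`). -/

noncomputable section

namespace SingularControl

/-! ### The functional `⟨1, ·⟩` on `L^p`. -/

section Pairing

variable {D : Type*} [MeasurableSpace D] {μ : Measure D} {p p' : ℝ≥0∞}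

theorem pairing_const [IsFiniteMeasure μ] (c : ℝ) (v : Lp ℝ p μ) :
    pairing (Lp.const p' μ c) v = c * ∫ x, v x ∂μ := by
  rw [pairing, ← integral_const_mul]
  refine integral_congr_ae ?_
  filter_upwards [Lp.coeFn_const p' μ c] with x hx
  rw [hx, Function.const_apply]

theorem pairing_smul_left (c : ℝ) (f : Lp ℝ p' μ) (v : Lp ℝ p μ) :
    pairing (c • f) v = c * pairing f v := by
  rw [pairing, pairing, ← integral_const_mul]
  refine integral_congr_ae ?_
  filter_upwards [Lp.coeFn_smul c f] with x hx
  rw [hx, Pi.smul_apply, smul_eq_mul, mul_assoc]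

theorem integrable_Lp [IsFiniteMeasure μ] [Fact (1 ≤ p)] (v : Lp ℝ p μ) : Integrable v μ :=
  (Lp.memLp v).integrable Fact.out

theorem integral_Lp_nonneg {v : Lp ℝ p μ} (hv : 0 ≤ v) : 0 ≤ ∫ x, v x ∂μ :=
  integral_nonneg_of_ae ((Lp.coeFn_nonneg v).2 hv)

variable (μ p) in
/-- Integration over a finite measure space as a continuous linear functional on `L^p`. -/
def integralLp [IsFiniteMeasure μ] [Fact (1 ≤ p)] : Lp ℝ p μ →L[ℝ] ℝ :=
  haveI : ENNReal.HolderConjugate (ENNReal.conjExponent p) p :=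
    (ENNReal.HolderConjugate.conjExponent Fact.out).symm
  haveI : Fact (1 ≤ ENNReal.conjExponent p) :=
    ⟨ENNReal.HolderConjugate.one_le (ENNReal.conjExponent p) p⟩
  (ContinuousLinearMap.mul ℝ ℝ).lpPairing μ (ENNReal.conjExponent p) p (Lp.const _ μ 1)

theorem integralLp_apply [IsFiniteMeasure μ] [Fact (1 ≤ p)] (v : Lp ℝ p μ) :
    integralLp μ p v = ∫ x, v x ∂μ := by
  rw [integralLp, ContinuousLinearMap.lpPairing_eq_integral]
  exact (pairing_const 1 v).trans (one_mul _)

end Pairing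

/-! ### Eigenvectors of the adjoint semigroup. -/

section Semigroup

variable {X : Type*} [NormedAddCommGroup X] [NormedSpace ℝ X]

/-- `S t` commutes with `S u`, so it maps the difference quotients of `f` to those of `S t f`. -/
theorem IsGenerator.apply_mem_graph {A : X →ₗ.[ℝ] X} {S : ℝ≥0 → X →L[ℝ] X}
    (hS : IsC0Semigroup S) (hAS : IsGenerator A S) {f g : X} (h : (f, g) ∈ A.graph) (t : ℝ≥0) :
    (S t f, S t g) ∈ A.graph := by
  rw [hAS] at h ⊢
  refine (((S t).continuous.tendsto g).comp h).congr fun u => ?_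
  have : S u (S t f) = S t (S u f) := by
    rw [← ContinuousLinearMap.comp_apply, ← ContinuousLinearMap.comp_apply, ← hS.map_add,
      ← hS.map_add, add_comm]
  simp [this]

theorem IsGenerator.hasDerivWithinAt {A : X →ₗ.[ℝ] X} {S : ℝ≥0 → X →L[ℝ] X}
    (hS : IsC0Semigroup S) (hAS : IsGenerator A S) {f g : X} (h : (f, g) ∈ A.graph) {t : ℝ}
    (ht : 0 ≤ t) :
    HasDerivWithinAt (fun s : ℝ => S s.toNNReal f) (S t.toNNReal g) (Set.Ici t) t := by
  rw [← hasDerivWithinAt_Ioi_iff_Ici, hasDerivWithinAt_iff_tendsto_slope' Set.self_notMem_Ioi]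
  have h1 := (hAS _ _).1 (hAS.apply_mem_graph hS h t.toNNReal)
  have h2 : Tendsto (fun s : ℝ => (s - t).toNNReal) (𝓝[>] t) (𝓝[>] 0) := by
    refine tendsto_nhdsWithin_iff.2 ⟨?_, ?_⟩
    · have : Continuous fun s : ℝ => (s - t).toNNReal := by fun_prop
      simpa using (this.tendsto t).mono_left nhdsWithin_le_nhds
    · filter_upwards [self_mem_nhdsWithin] with s hs
      simpa using hs
  refine (h1.comp h2).congr' ?_
  filter_upwards [self_mem_nhdsWithin] with s hs
  have hs' : t < s := hs
  have : s.toNNReal = (s - t).toNNReal + t.toNNReal := by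
    rw [← Real.toNNReal_add (by linarith) ht, sub_add_cancel]
  rw [slope_def_module, this, hS.map_add]
  simp [Real.coe_toNNReal _ (sub_nonneg.2 hs'.le)]

/-- A continuous functional that is an eigenvector of the adjoint of the generator is an
eigenvector of the adjoint semigroup. -/
theorem IsGenerator.functional_apply {A : X →ₗ.[ℝ] X} {S : ℝ≥0 → X →L[ℝ] X}
    (hS : IsC0Semigroup S) (hAS : IsGenerator A S) (hA : Dense (A.domain : Set X))
    (ℓ : X →L[ℝ] ℝ) (c : ℝ) (hℓ : ∀ f : A.domain, ℓ (A f) = c * ℓ f) (t : ℝ≥0) (v : X) :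
    ℓ (S t v) = Real.exp (c * t) * ℓ v := by
  suffices h : Set.EqOn (fun v => ℓ (S t v)) (fun v => Real.exp (c * t) * ℓ v) A.domain from
    congrFun (Continuous.ext_on hA (by fun_prop) (by fun_prop) h) v
  intro f hf
  have hgr : ∀ u, ℓ (S u (A ⟨f, hf⟩)) = c * ℓ (S u f) := by
    intro u
    have := hAS.apply_mem_graph hS (A.mem_graph ⟨f, hf⟩) u
    obtain ⟨x, hx, hx'⟩ := (LinearPMap.mem_graph_iff A).1 this
    simp only at hx hx'
    rw [← hx', ← hx, hℓ]
  have hcont : Continuous fun s : ℝ => ℓ (S s.toNNReal f) :=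
    ℓ.continuous.comp ((hS.continuous_orbit f).comp continuous_real_toNNReal)
  -- The product rule and `hgr` make the right derivative of `e^{-cs} ℓ(S_s f)` vanish. A continuous
  -- function with zero right derivative is constant, so two-sided differentiability of orbits is
  -- not needed.
  have hd : ∀ s ∈ Set.Ico (0 : ℝ) t, HasDerivWithinAt
      (fun s : ℝ => Real.exp (-c * s) * ℓ (S s.toNNReal f)) 0 (Set.Ici s) s := by
    intro s hs
    have h1 := (ℓ.hasFDerivAt.comp_hasDerivWithinAt s
      (hAS.hasDerivWithinAt hS (A.mem_graph ⟨f, hf⟩) hs.1))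
    have h2 : HasDerivWithinAt (fun s : ℝ => Real.exp (-c * s)) (Real.exp (-c * s) * (-c))
        (Set.Ici s) s := by
      simpa using ((hasDerivAt_id s).const_mul (-c)).exp.hasDerivWithinAt
    convert! h2.mul h1 using 1
    simp only [hgr, Function.comp_apply]
    ring
  have hcont' : Continuous fun s : ℝ => Real.exp (-c * s) * ℓ (S s.toNNReal f) :=
    (Real.continuous_exp.comp (continuous_const_mul (-c))).mul hcont
  have := constant_of_has_deriv_right_zero hcont'.continuousOn hd t ⟨t.2, le_rfl⟩
  simp only [Real.toNNReal_coe, mul_zero, Real.exp_zero, one_mul, Real.toNNReal_zero, hS.map_zero,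
    ContinuousLinearMap.coe_id', id] at this
  change ℓ (S t f) = Real.exp (c * t) * ℓ f
  rw [← this, ← mul_assoc, ← Real.exp_add]
  simp

end Semigroup

theorem integral_semigroup {D : Type*} [MeasurableSpace D] {μ : Measure D} [IsFiniteMeasure μ]
    {p p' : ℝ≥0∞} [Fact (1 ≤ p)] {A : Lp ℝ p μ →ₗ.[ℝ] Lp ℝ p μ}
    {S : ℝ≥0 → Lp ℝ p μ →L[ℝ] Lp ℝ p μ} (hS : IsC0Semigroup S) (hAS : IsGenerator A S)
    (hA : Dense (A.domain : Set (Lp ℝ p μ))) {c : ℝ}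
    (hc : IsAdjointPair A (Lp.const p' μ (1 : ℝ)) (c • Lp.const p' μ (1 : ℝ)))
    (t : ℝ≥0) (v : Lp ℝ p μ) :
    ∫ x, S t v x ∂μ = Real.exp (c * t) * ∫ x, v x ∂μ := by
  rw [← integralLp_apply, ← integralLp_apply]
  refine hAS.functional_apply hS hA _ c (fun f => ?_) t v
  have := hc f
  rwa [pairing_smul_left, pairing_const, pairing_const, one_mul, one_mul, ← integralLp_apply,
    ← integralLp_apply] at this

/-! ### Change of time. -/

instance : IsFiniteMeasureOnCompacts lebesgue :=
  .comap' _ NNReal.continuous_coe (MeasurableEmbedding.subtype_coe measurableSet_Ici)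

instance : SigmaFinite lebesgue := inferInstance

/-- Two measures on `[0, ∞)` that are finite on bounded intervals and agree on all intervals
`[0, t]` are equal. -/
theorem measure_ext_of_Iic {M M' : Measure ℝ≥0} (hM : ∀ t, M (Set.Iic t) ≠ ∞)
    (h : ∀ t, M (Set.Iic t) = M' (Set.Iic t)) : M = M' := by
  refine Measure.ext_of_generateFrom_of_iUnion (Set.range Set.Iic) (fun n : ℕ => Set.Iic (n : ℝ≥0))
    ((BorelSpace.measurable_eq (α := ℝ≥0)).trans (borel_eq_generateFrom_Iic _)) isPiSystem_Iic ?_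
    (fun n => ⟨_, rfl⟩) (fun n => hM _) ?_
  · refine Set.eq_univ_of_forall fun x => ?_
    obtain ⟨n, hn⟩ := exists_nat_ge x
    exact Set.mem_iUnion.2 ⟨n, hn⟩
  · rintro _ ⟨t, rfl⟩
    exact h t

theorem measurable_ennreal_of_le_coe {α : Type*} [MeasurableSpace α] {T : α → ℝ≥0∞}
    (h : ∀ s : ℝ≥0, MeasurableSet {a | T a ≤ s}) : Measurable T := by
  refine measurable_of_Iic fun x => ?_
  induction x with
  | top => simp
  | coe x => exact h x

/-- The change of time formula: `T` is the inverse of the distribution function `N` of `M`. -/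
theorem lintegral_eq_lintegral_inverse {M : Measure ℝ≥0} {N : ℝ≥0 → ℝ}
    (hM : ∀ t, M (Set.Iic t) = ENNReal.ofReal (N t)) {T : ℝ → ℝ≥0∞}
    (hT : ∀ u (s : ℝ≥0), T u ≤ s ↔ u ≤ N s) {f : ℝ≥0 → ℝ≥0∞} (hf : Measurable f) :
    ∫⁻ s, f s ∂M =
      ∫⁻ u in Set.Ioi (0 : ℝ), {u | T u < ∞}.indicator (fun u => f (T u).toNNReal) u := by
  have hTm : Measurable T := measurable_ennreal_of_le_coe fun s => by
    simp only [hT]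
    exact measurableSet_Iic
  have hset : MeasurableSet {u | T u < ∞} := measurableSet_lt hTm measurable_const
  have hTn : Measurable fun u => (T u).toNNReal := hTm.ennreal_toNNReal
  -- `M` is the image of Lebesgue measure on `(0, ∞) ∩ {T < ∞}` under `T`: both give `[0, t]` the
  -- mass of `(0, N t]`. Starting at level `0` accounts for the atom of `M` at time `0`.
  have key : M = (((volume.restrict (Set.Ioi (0 : ℝ))).restrict {u | T u < ∞}).map
      fun u => (T u).toNNReal) := by
    refine measure_ext_of_Iic (fun t => by simp [hM]) fun t => ?_
    rw [Measure.map_apply hTn measurableSet_Iic, Measure.restrict_apply (hTn measurableSet_Iic),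
      Measure.restrict_apply ((hTn measurableSet_Iic).inter hset), hM]
    have : (fun u => (T u).toNNReal) ⁻¹' Set.Iic t ∩ {u | T u < ∞} ∩ Set.Ioi 0
        = Set.Ioc 0 (N t) := by
      ext u
      simp only [Set.mem_inter_iff, Set.mem_preimage, Set.mem_Iic, Set.mem_ofPred_eq, Set.mem_Ioi,
        Set.mem_Ioc]
      constructor
      · rintro ⟨⟨h1, h2⟩, h3⟩
        refine ⟨h3, (hT u t).1 ?_⟩
        rw [← ENNReal.coe_toNNReal h2.ne]
        exact_mod_cast h1
      · rintro ⟨h1, h2⟩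
        have h3 := (hT u t).2 h2
        have h4 : T u < ∞ := h3.trans_lt ENNReal.coe_lt_top
        refine ⟨⟨?_, h4⟩, h1⟩
        rw [← ENNReal.coe_toNNReal h4.ne] at h3
        exact_mod_cast h3
    rw [this, Real.volume_Ioc, sub_zero]
  conv_lhs => rw [key]
  rw [lintegral_map hf hTn, lintegral_indicator hset]

/-- The inverse `u ↦ inf {s | u ≤ N s}` of a nondecreasing function, restricted to the event that
`G` holds. -/
def levelTime (G : Prop) (N : ℝ≥0 → ℝ) (u : ℝ) : ℝ≥0∞ :=
  sInf {x | ∃ s : ℝ≥0, x = s ∧ G ∧ u ≤ N s}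

/-- Right-continuity makes the infimum attained. This non-strict equivalence makes `levelTime` a
stopping time without a right-continuous filtration. -/
theorem levelTime_le_coe_iff {G : Prop} {N : ℝ≥0 → ℝ} (hmono : G → Monotone N)
    (hcont : G → ∀ t, ContinuousWithinAt N (Set.Ici t) t) (u : ℝ) (s : ℝ≥0) :
    levelTime G N u ≤ s ↔ G ∧ u ≤ N s := by
  constructor
  · intro h
    have hlt : ∀ t : ℝ≥0, s < t → G ∧ u ≤ N t := by
      intro t ht
      have : levelTime G N u < t := h.trans_lt (by exact_mod_cast ht)
      obtain ⟨_, ⟨q, rfl, hG, hq⟩, hqt⟩ := sInf_lt_iff.1 this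
      exact ⟨hG, hq.trans (hmono hG (by exact_mod_cast hqt.le))⟩
    have hG := (hlt (s + 1) (by simp)).1
    refine ⟨hG, ?_⟩
    have h1 : Tendsto N (𝓝[>] s) (𝓝 (N s)) :=
      (hcont hG s).mono_left (nhdsWithin_mono _ Set.Ioi_subset_Ici_self)
    refine ge_of_tendsto h1 ?_
    filter_upwards [self_mem_nhdsWithin] with t ht
    exact (hlt t ht).2
  · rintro ⟨hG, h⟩
    exact sInf_le ⟨s, rfl, hG, h⟩

/-! ### Domination at stopping times. -/

variable {Ω : Type*} {mΩ : MeasurableSpace Ω}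

/-- Below level `s`, the event `{min σ s < x}` is a countable union of events `{σ ≤ q}` with `q`
rational and `q ≤ s`, all known at time `s`. -/
theorem measurable_min_stopping {m : MeasurableSpace Ω} {σ : Ω → ℝ≥0∞} {s : ℝ≥0}
    (h : ∀ t ≤ s, MeasurableSet {ω | σ ω ≤ (t : ℝ≥0)}) :
    Measurable fun ω => (min (σ ω) s).toNNReal := by
  refine Measurable.ennreal_toNNReal (measurable_of_Iio fun x => ?_)
  rcases lt_or_ge (s : ℝ≥0∞) x with hx | hx
  · convert MeasurableSet.univ
    ext ω
    simp [hx]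
  · have : (fun ω => min (σ ω) s) ⁻¹' Set.Iio x =
        ⋃ q : {q : ℚ // (Real.toNNReal q : ℝ≥0∞) < x}, {ω | σ ω ≤ Real.toNNReal q} := by
      ext ω
      simp only [Set.mem_preimage, Set.mem_Iio, min_lt_iff, hx.not_gt, or_false, Set.mem_iUnion,
        Set.mem_ofPred_eq, Subtype.exists, exists_prop]
      constructor
      · intro hlt
        obtain ⟨q, -, hq, hq'⟩ := ENNReal.lt_iff_exists_rat_btwn.1 hlt
        exact ⟨q, hq', hq.le⟩
      · rintro ⟨q, hq, hq'⟩
        exact hq'.trans_lt hq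
    rw [this]
    refine MeasurableSet.iUnion fun q => h _ ?_
    exact_mod_cast (q.2.le.trans hx)

/-- The smallest point of the grid `{k / (n + 1)}` above `s`. -/
def gridCeil (n : ℕ) (s : ℝ≥0) : ℝ≥0 := ⌈s * (n + 1)⌉₊ / (n + 1)

theorem le_gridCeil (n : ℕ) (s : ℝ≥0) : s ≤ gridCeil n s := by
  rw [gridCeil, le_div_iff₀ (by positivity)]
  exact Nat.le_ceil _

theorem tendsto_gridCeil (s : ℝ≥0) : Tendsto (fun n => gridCeil n s) atTop (𝓝[≥] s) := by
  refine tendsto_nhdsWithin_iff.2 ⟨?_, .of_forall fun n => le_gridCeil n s⟩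
  have h : Tendsto (fun n : ℕ => s + 1 / ((n : ℝ≥0) + 1)) atTop (𝓝 (s + 0)) :=
    tendsto_const_nhds.add tendsto_one_div_add_atTop_nhds_zero_nat
  rw [add_zero] at h
  refine tendsto_of_tendsto_of_tendsto_of_le_of_le tendsto_const_nhds h (fun n => le_gridCeil n s)
    fun n => ?_
  simp only [gridCeil]
  rw [div_le_iff₀ (by positivity), add_mul, one_div_mul_cancel (by positivity)]
  exact (Nat.ceil_lt_add_one zero_le).le

theorem gridCeil_eq_iff (n k : ℕ) (s : ℝ≥0) :
    gridCeil n s = k / (n + 1) ↔ s ≤ k / (n + 1) ∧ ∀ j < k, ¬ s ≤ j / (n + 1) := by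
  have h : ∀ j : ℕ, s ≤ j / (n + 1) ↔ ⌈s * (n + 1)⌉₊ ≤ j := fun j => by
    rw [le_div_iff₀ (by positivity), Nat.ceil_le]
  rw [gridCeil, div_left_inj' (by positivity)]
  simp only [h, Nat.cast_inj]
  constructor
  · rintro rfl
    exact ⟨le_rfl, fun j hj => hj.not_ge⟩
  · rintro ⟨h1, h2⟩
    by_contra h3
    exact h2 _ (lt_of_le_of_ne h1 h3) le_rfl

/-- If `ζ` is dominated by `ψ` in conditional expectation at every deterministic time and `ψ` is
progressive and right-continuous, then the domination extends to stopping times. -/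
theorem lintegral_stopped_le {P : Measure Ω} [IsFiniteMeasure P] {𝒢 : Filtration ℝ≥0 mΩ}
    {ζ ψ : ℝ≥0 → Ω → ℝ≥0∞} (hζ : ∀ s, Measurable (ζ s)) (hψ : IsProgressive 𝒢 ψ)
    (hle : ∀ s A, MeasurableSet[𝒢 s] A → ∫⁻ ω in A, ζ s ω ∂P ≤ ∫⁻ ω in A, ψ s ω ∂P)
    (hζ_cont : ∀ᵐ ω ∂P, ∀ t, ContinuousWithinAt (fun s => ζ s ω) (Set.Ici t) t)
    (hψ_cont : ∀ᵐ ω ∂P, ∀ t, ContinuousWithinAt (fun s => ψ s ω) (Set.Ici t) t)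
    (hψ_fin : ∀ᵐ ω ∂P, ∀ t, ψ t ω ≠ ∞)
    {σ : Ω → ℝ≥0∞} (hσ : ∀ s : ℝ≥0, MeasurableSet[𝒢 s] {ω | σ ω ≤ s}) :
    ∫⁻ ω, {ω | σ ω < ∞}.indicator (fun ω => ζ (σ ω).toNNReal ω) ω ∂P ≤
      ∫⁻ ω, {ω | σ ω < ∞}.indicator (fun ω => ψ (σ ω).toNNReal ω) ω ∂P := by
  refine ENNReal.le_of_forall_pos_le_add fun ε hε _ => ?_
  obtain ⟨δ, hδ, hδε⟩ := ENNReal.exists_nnreal_pos_mul_lt (measure_ne_top P Set.univ)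
    (ENNReal.coe_ne_zero.2 hε.ne')
  let s : ℕ → ℕ → ℝ≥0 := fun n k => k / (n + 1)
  -- On `E n k` the grid approximation of `σ` from above equals `s n k`. On `F n k` the value of `ψ`
  -- there exceeds its value at `σ` by at most `δ`. The minimum with `s n k` makes `F n k` known at
  -- time `s n k`, by progressive measurability; restricting to it replaces a dominating function
  -- for `ψ`, which need not exist.
  let E : ℕ → ℕ → Set Ω := fun n k =>
    {ω | σ ω ≤ s n k} ∩ ⋂ j < k, {ω | σ ω ≤ s n j}ᶜ
  let F : ℕ → ℕ → Set Ω := fun n k =>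
    {ω | ψ (s n k) ω ≤ ψ (min (σ ω) (s n k)).toNNReal ω + δ}
  have hs_mono : ∀ n {j k : ℕ}, j ≤ k → s n j ≤ s n k := fun n j k hjk => by
    simp only [s]
    gcongr
  have hEm : ∀ n k, MeasurableSet[𝒢 (s n k)] (E n k) := fun n k =>
    MeasurableSet.inter (hσ _) (MeasurableSet.iInter fun j => MeasurableSet.iInter fun hj =>
      (𝒢.mono (hs_mono n hj.le) _ (hσ _)).compl)
  have hFm : ∀ n k, MeasurableSet[𝒢 (s n k)] (F n k) := fun n k => by
    have h1 : Measurable[𝒢 (s n k)] fun ω => (min (σ ω) (s n k)).toNNReal :=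
      measurable_min_stopping fun t ht => 𝒢.mono ht _ (hσ t)
    have hle : ∀ ω, (min (σ ω) (s n k)).toNNReal ≤ s n k := fun ω => by
      have := ENNReal.toNNReal_mono ENNReal.coe_ne_top (min_le_right (σ ω) (s n k))
      simpa using this
    have h3 : @Measurable _ _ (𝒢 (s n k)) (Subtype.instMeasurableSpace.prod (𝒢 (s n k))) fun ω =>
        ((⟨(min (σ ω) (s n k)).toNNReal, hle ω⟩ : Set.Iic (s n k)), ω) :=
      Measurable.prodMk (Measurable.subtype_mk h1) measurable_id
    have h2 : Measurable[𝒢 (s n k)] fun ω => ψ (min (σ ω) (s n k)).toNNReal ω :=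
      (hψ (s n k)).comp h3
    exact measurableSet_le (hψ.adapted (s n k)) (h2.add_const _)
  have hEF : ∀ n k, MeasurableSet[𝒢 (s n k)] (E n k ∩ F n k) := fun n k =>
    MeasurableSet.inter (hEm n k) (hFm n k)
  have hEF' : ∀ n k, MeasurableSet (E n k ∩ F n k) := fun n k => 𝒢.le _ _ (hEF n k)
  have hdisj : ∀ n, Pairwise (Function.onFun Disjoint fun k => E n k ∩ F n k) := fun n => by
    refine (pairwise_disjoint_on _).2 fun j k hjk => Set.disjoint_left.2 fun ω hj hk => ?_
    exact Set.mem_iInter₂.1 hk.1.2 j hjk hj.1.1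
  let H : ℕ → Ω → ℝ≥0∞ := fun n ω => ∑' k, (E n k ∩ F n k).indicator (ζ (s n k)) ω
  have hHm : ∀ n, Measurable (H n) := fun n =>
    Measurable.tsum fun k => (hζ _).indicator (hEF' n k)
  have hσE : ∀ n k ω, ω ∈ E n k → σ ω < ∞ := fun n k ω hω => hω.1.trans_lt ENNReal.coe_lt_top
  have hH : ∀ n, ∫⁻ ω, H n ω ∂P ≤
      ∫⁻ ω, {ω | σ ω < ∞}.indicator (fun ω => ψ (σ ω).toNNReal ω) ω ∂P + ε := by
    intro n
    calc ∫⁻ ω, H n ω ∂P = ∑' k, ∫⁻ ω in E n k ∩ F n k, ζ (s n k) ω ∂P := by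
          simp only [H]
          rw [lintegral_tsum fun k => ((hζ _).indicator (hEF' n k)).aemeasurable]
          simp_rw [lintegral_indicator (hEF' n _)]
      _ ≤ ∑' k, ∫⁻ ω in E n k ∩ F n k, ψ (s n k) ω ∂P :=
          ENNReal.tsum_le_tsum fun k => hle _ _ (hEF n k)
      _ ≤ ∑' k, ∫⁻ ω in E n k ∩ F n k,
            ({ω | σ ω < ∞}.indicator (fun ω => ψ (σ ω).toNNReal ω) ω + δ) ∂P := by
          refine ENNReal.tsum_le_tsum fun k => setLIntegral_mono' (hEF' n k) fun ω hω => ?_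
          have h1 : ψ (s n k) ω ≤ ψ (min (σ ω) (s n k)).toNNReal ω + δ := hω.2
          rw [min_eq_left hω.1.1] at h1
          rwa [Set.indicator_of_mem (show ω ∈ {ω | σ ω < ∞} from hσE n k ω hω.1)]
      _ = ∫⁻ ω in ⋃ k, E n k ∩ F n k,
            ({ω | σ ω < ∞}.indicator (fun ω => ψ (σ ω).toNNReal ω) ω + δ) ∂P :=
          (lintegral_iUnion (hEF' n) (hdisj n) _).symm
      _ ≤ ∫⁻ ω, ({ω | σ ω < ∞}.indicator (fun ω => ψ (σ ω).toNNReal ω) ω + δ) ∂P :=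
          setLIntegral_le_lintegral _ _
      _ ≤ _ := by
          rw [lintegral_add_right _ measurable_const, lintegral_const]
          gcongr
  -- Right-continuity of `ψ` puts `ω` in the relevant `F n k` for all large `n`, so the loss from
  -- restricting to `F` disappears in the limit. Fatou's lemma on the side of `ζ` concludes.
  have hlim : ∀ᵐ ω ∂P, {ω | σ ω < ∞}.indicator (fun ω => ζ (σ ω).toNNReal ω) ω ≤
      liminf (fun n => H n ω) atTop := by
    filter_upwards [hζ_cont, hψ_cont, hψ_fin] with ω h1 h2 h3
    by_cases hω : σ ω < ∞
    · rw [Set.indicator_of_mem (show ω ∈ {ω | σ ω < ∞} from hω)]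
      set t := (σ ω).toNNReal with ht
      have hσt : σ ω = t := (ENNReal.coe_toNNReal hω.ne).symm
      rw [← ((h1 t).tendsto.comp (tendsto_gridCeil t)).liminf_eq]
      refine liminf_le_liminf ?_
      have h4 : ∀ᶠ n in atTop, ψ (gridCeil n t) ω < ψ t ω + δ :=
        ((h2 t).tendsto.comp (tendsto_gridCeil t)).eventually_lt_const
          (ENNReal.lt_add_right (h3 t) (by simpa using hδ.ne'))
      filter_upwards [h4] with n hn
      have hk : gridCeil n t = s n ⌈t * (n + 1)⌉₊ := rfl
      have hk' := (gridCeil_eq_iff n _ t).1 hk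
      refine le_trans (le_of_eq ?_) (ENNReal.le_tsum ⌈t * ((n : ℝ≥0) + 1)⌉₊)
      rw [Set.indicator_of_mem, Function.comp_apply, hk]
      refine ⟨⟨?_, ?_⟩, ?_⟩
      · simpa [hσt] using hk'.1
      · simpa [hσt] using hk'.2
      · have : min (σ ω) (gridCeil n t) = t := by
          rw [hσt]
          exact min_eq_left (by exact_mod_cast le_gridCeil n t)
        simp only [F, Set.mem_ofPred_eq, ← hk, this, ENNReal.toNNReal_coe]
        exact hn.le
    · simp [Set.indicator_of_notMem (show ω ∉ {ω | σ ω < ∞} from hω)]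
  calc _ ≤ ∫⁻ ω, liminf (fun n => H n ω) atTop ∂P := lintegral_mono_ae hlim
    _ ≤ liminf (fun n => ∫⁻ ω, H n ω ∂P) atTop := lintegral_liminf_le hHm
    _ ≤ _ := liminf_le_of_le (by isBoundedDefault) fun b hb => by
        obtain ⟨n, hn⟩ := hb.exists
        exact hn.trans (hH n)

/-! ### Domination integrated along an increasing process. -/

section Stochastic

variable {Ω : Type*} {mΩ : MeasurableSpace Ω}

/-- The augmentation of a filtration by the measurable null sets. -/
def augmentation (ℱ : Filtration ℝ≥0 mΩ) (P : Measure Ω) : Filtration ℝ≥0 mΩ where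
  -- `P` need not be complete, so the meet with `mΩ` keeps the sets measurable.
  seq t := eventuallyMeasurableSpace (ℱ t) (ae P) ⊓ mΩ
  mono' := fun _ _ h => inf_le_inf_right _ fun _ ⟨B, hB, hAB⟩ => ⟨B, ℱ.mono h _ hB, hAB⟩
  le' _ := inf_le_right

theorem measurableSet_augmentation_iff {ℱ : Filtration ℝ≥0 mΩ} {P : Measure Ω} {t : ℝ≥0}
    {A : Set Ω} : MeasurableSet[augmentation ℱ P t] A ↔
      (∃ B, MeasurableSet[ℱ t] B ∧ A =ᵐ[P] B) ∧ MeasurableSet A :=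
  MeasurableSpace.measurableSet_inf

theorem le_augmentation (ℱ : Filtration ℝ≥0 mΩ) (P : Measure Ω) (t : ℝ≥0) :
    ℱ t ≤ augmentation ℱ P t :=
  le_inf le_eventuallyMeasurableSpace (ℱ.le t)

theorem isProgressive_augmentation {β : Type*} [MeasurableSpace β] {ℱ : Filtration ℝ≥0 mΩ}
    {u : ℝ≥0 → Ω → β} (hu : IsProgressive ℱ u) (P : Measure Ω) :
    IsProgressive (augmentation ℱ P) u := fun t =>
  (hu t).mono (sup_le_sup le_rfl (MeasurableSpace.comap_mono (le_augmentation ℱ P t))) le_rfl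

/-- Stopping the time argument at `n` gives jointly measurable maps that are eventually constant in
`n` at each point. -/
theorem measurable_uncurry_of_isProgressive {β : Type*} [MeasurableSpace β] [TopologicalSpace β]
    [TopologicalSpace.PseudoMetrizableSpace β] [BorelSpace β] {ℱ : Filtration ℝ≥0 mΩ}
    {u : ℝ≥0 → Ω → β} (hu : IsProgressive ℱ u) :
    Measurable (Function.uncurry u) := by
  have h : ∀ n : ℕ, Measurable fun x : ℝ≥0 × Ω => u (min x.1 n) x.2 := fun n => by
    have h1 : Measurable fun p : Set.Iic (n : ℝ≥0) × Ω => u p.1 p.2 :=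
      (hu n).mono (sup_le_sup le_rfl (MeasurableSpace.comap_mono (ℱ.le _))) le_rfl
    have h2 : Measurable fun x : ℝ≥0 × Ω =>
        ((⟨min x.1 n, Set.mem_Iic.2 (min_le_right _ _)⟩ : Set.Iic (n : ℝ≥0)), x.2) := by fun_prop
    exact h1.comp h2
  refine measurable_of_tendsto_metrizable h (tendsto_pi_nhds.2 fun x => ?_)
  refine tendsto_const_nhds.congr' ?_
  obtain ⟨n, hn⟩ := exists_nat_ge x.1
  filter_upwards [eventually_ge_atTop n] with k hk
  rw [min_eq_left (hn.trans (by exact_mod_cast hk))]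
  rfl

/-- If `ζ` is dominated by `ψ` in conditional expectation at every deterministic time and `ψ` is
progressive and right-continuous, then `E ∫ ζ dN ≤ E ∫ ψ dN` for every adapted nondecreasing
right-continuous process `N`. -/
theorem lintegral_lintegral_le {P : Measure Ω} [IsFiniteMeasure P] {ℱ : Filtration ℝ≥0 mΩ}
    {ζ ψ : ℝ≥0 → Ω → ℝ≥0∞} (hζ : Measurable (Function.uncurry ζ)) (hψ : IsProgressive ℱ ψ)
    (hle : ∀ s A, MeasurableSet[ℱ s] A → ∫⁻ ω in A, ζ s ω ∂P ≤ ∫⁻ ω in A, ψ s ω ∂P)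
    (hζ_cont : ∀ᵐ ω ∂P, ∀ t, ContinuousWithinAt (fun s => ζ s ω) (Set.Ici t) t)
    (hψ_cont : ∀ᵐ ω ∂P, ∀ t, ContinuousWithinAt (fun s => ψ s ω) (Set.Ici t) t)
    (hψ_fin : ∀ᵐ ω ∂P, ∀ t, ψ t ω ≠ ∞)
    {N : ℝ≥0 → Ω → ℝ} (hN : ∀ t, Measurable[ℱ t] (N t))
    (hN_mono : ∀ᵐ ω ∂P, Monotone fun t => N t ω)
    (hN_cont : ∀ᵐ ω ∂P, ∀ t, ContinuousWithinAt (fun s => N s ω) (Set.Ici t) t)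
    {M : Ω → Measure ℝ≥0} (hM : ∀ᵐ ω ∂P, ∀ t, M ω (Set.Iic t) = ENNReal.ofReal (N t ω)) :
    ∫⁻ ω, ∫⁻ s, ζ s ω ∂(M ω) ∂P ≤ ∫⁻ ω, ∫⁻ s, ψ s ω ∂(M ω) ∂P := by
  -- Path properties hold only almost surely, so `T` is set to `∞` off a measurable full-measure set
  -- `G`. As `G` need not belong to `ℱ s`, `T u` is a stopping time for the augmented filtration
  -- only.
  obtain ⟨G, hGP, hGm, hG⟩ := (hN_mono.and (hN_cont.and hM)).exists_measurable_mem
  let T : ℝ → Ω → ℝ≥0∞ := fun u ω => levelTime (ω ∈ G) (fun t => N t ω) u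
  have hT : ∀ u ω (s : ℝ≥0), T u ω ≤ s ↔ ω ∈ G ∧ u ≤ N s ω := fun u ω s =>
    levelTime_le_coe_iff (fun h => (hG ω h).1) (fun h => (hG ω h).2.1) u s
  have hTm : Measurable fun x : Ω × ℝ => T x.2 x.1 := measurable_ennreal_of_le_coe fun s => by
    simp only [hT]
    exact (measurable_fst hGm).inter
      (measurableSet_le measurable_snd (((hN s).mono (ℱ.le s) le_rfl).comp measurable_fst))
  have hTs : ∀ u (s : ℝ≥0), MeasurableSet[augmentation ℱ P s] {ω | T u ω ≤ s} := fun u s => by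
    have h1 : MeasurableSet[ℱ s] {ω | u ≤ N s ω} := measurableSet_le measurable_const (hN s)
    refine measurableSet_augmentation_iff.2 ⟨⟨_, h1, ?_⟩, ?_⟩
    · filter_upwards [hGP] with ω hω
      refine propext ?_
      change T u ω ≤ s ↔ u ≤ N s ω
      simp [hT, hω]
    · simp only [hT]
      exact hGm.inter (ℱ.le s _ h1)
  have hψ' : Measurable (Function.uncurry ψ) := measurable_uncurry_of_isProgressive hψ
  -- No measurability of `ω ↦ M ω` is assumed; the change of time gives a jointly measurable
  -- integrand, to which Tonelli applies.
  have key : ∀ {f : ℝ≥0 → Ω → ℝ≥0∞}, Measurable (Function.uncurry f) →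
      ∫⁻ ω, ∫⁻ s, f s ω ∂(M ω) ∂P = ∫⁻ u in Set.Ioi (0 : ℝ), ∫⁻ ω,
        {ω | T u ω < ∞}.indicator (fun ω => f (T u ω).toNNReal ω) ω ∂P := by
    intro f hf
    have h1 : Measurable fun x : Ω × ℝ =>
        {x : Ω × ℝ | T x.2 x.1 < ∞}.indicator (fun x => f (T x.2 x.1).toNNReal x.1) x :=
      (hf.comp (hTm.ennreal_toNNReal.prodMk measurable_fst)).indicator
        (measurableSet_lt hTm measurable_const)
    refine Eq.trans ?_ (lintegral_lintegral_swap
      (f := fun ω u => {ω | T u ω < ∞}.indicator (fun ω => f (T u ω).toNNReal ω) ω)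
      h1.aemeasurable)
    refine lintegral_congr_ae ?_
    filter_upwards [hGP] with ω hω
    exact lintegral_eq_lintegral_inverse (T := fun u => T u ω) (hG ω hω).2.2
      (fun u s => by simp [hT, hω]) (hf.comp measurable_prodMk_right)
  rw [key hζ, key hψ']
  refine lintegral_mono fun u => ?_
  refine lintegral_stopped_le (fun s => hζ.comp measurable_prodMk_left)
    (isProgressive_augmentation hψ P) (fun s A hA => ?_) hζ_cont hψ_cont hψ_fin (hTs u)
  obtain ⟨⟨B, hB, hAB⟩, -⟩ := measurableSet_augmentation_iff.1 hA
  rw [setLIntegral_congr hAB, setLIntegral_congr hAB]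
  exact hle s B hB

end Stochastic

/-! ### Tail integrals. -/

section Tail

theorem lebesgue_singleton (s : ℝ≥0) : lebesgue {s} = 0 := by
  have h : MeasurableEmbedding ((↑) : ℝ≥0 → ℝ) := .subtype_coe measurableSet_Ici
  rw [lebesgue, h.comap_apply]
  simp

theorem continuous_lintegral_Ici {w : ℝ≥0 → ℝ≥0∞} (hw : Measurable w)
    (hfin : ∫⁻ t, w t ∂lebesgue ≠ ∞) : Continuous fun s => ∫⁻ t in Set.Ici s, w t ∂lebesgue := by
  rw [continuous_iff_continuousAt]
  intro s
  simp_rw [← lintegral_indicator measurableSet_Ici]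
  refine tendsto_lintegral_filter_of_dominated_convergence w
    (.of_forall fun u => hw.indicator measurableSet_Ici)
    (.of_forall fun u => .of_forall fun t => Set.indicator_le_self _ _ _) hfin ?_
  have h0 : ∀ᵐ t ∂lebesgue, t ≠ s := by simp [ae_iff, lebesgue_singleton]
  filter_upwards [h0] with t ht
  refine tendsto_const_nhds.congr' ?_
  rcases lt_or_gt_of_ne ht with h | h
  · filter_upwards [eventually_gt_nhds h] with u hu
    simp [hu, h]
  · filter_upwards [eventually_lt_nhds h] with u hu
    simp [hu.le, h.le]

theorem measurable_lintegral_Ici {Ω : Type*} [MeasurableSpace Ω] {w : ℝ≥0 → Ω → ℝ≥0∞}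
    (hw : Measurable (Function.uncurry w)) :
    Measurable (Function.uncurry fun s ω => ∫⁻ t in Set.Ici s, w t ω ∂lebesgue) := by
  have h : Measurable fun x : (ℝ≥0 × Ω) × ℝ≥0 =>
      {x : (ℝ≥0 × Ω) × ℝ≥0 | x.1.1 ≤ x.2}.indicator (fun x => w x.2 x.1.2) x :=
    (hw.comp (measurable_snd.prodMk (measurable_snd.comp measurable_fst))).indicator
      (measurableSet_le (by fun_prop) (by fun_prop))
  convert! h.lintegral_prod_right' (ν := lebesgue) with x
  rw [Function.uncurry, ← lintegral_indicator measurableSet_Ici]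
  rfl

/-- Tonelli's theorem on the triangle `s ≤ t`. -/
theorem lintegral_lintegral_Iic {M : Measure ℝ≥0} [SFinite M] {a : ℝ≥0 → ℝ≥0∞} (ha : Measurable a)
    {b : ℝ≥0 → ℝ≥0 → ℝ≥0∞} (hb : Measurable (Function.uncurry b)) :
    ∫⁻ t, a t * ∫⁻ s in Set.Iic t, b t s ∂M ∂lebesgue =
      ∫⁻ s, ∫⁻ t in Set.Ici s, a t * b t s ∂lebesgue ∂M := by
  have h : Measurable fun x : ℝ≥0 × ℝ≥0 =>
      {x : ℝ≥0 × ℝ≥0 | x.2 ≤ x.1}.indicator (fun x => a x.1 * b x.1 x.2) x :=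
    ((ha.comp measurable_fst).mul hb).indicator (measurableSet_le measurable_snd measurable_fst)
  calc _ = ∫⁻ t, ∫⁻ s, {x : ℝ≥0 × ℝ≥0 | x.2 ≤ x.1}.indicator (fun x => a x.1 * b x.1 x.2) (t, s)
        ∂M ∂lebesgue := by
        refine lintegral_congr fun t => ?_
        rw [← lintegral_const_mul _ (show Measurable (b t) from hb.comp measurable_prodMk_left),
          ← lintegral_indicator measurableSet_Iic]
        rfl
    _ = _ := by
        rw [lintegral_lintegral_swap h.aemeasurable]
        refine lintegral_congr fun s => ?_
        rw [← lintegral_indicator measurableSet_Ici]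
        rfl

end Tail

/-- The threshold `B` solves `B ^ (β - 1) = ε`: above it the linear term dominates, below it `B ^ β`
does. -/
theorem exists_rpow_le_mul_add {β ε : ℝ} (hβ : β ∈ Set.Ioo (0 : ℝ) 1) (hε : 0 < ε) :
    ∃ C : ℝ, 0 ≤ C ∧ ∀ x : ℝ, 0 ≤ x → x ^ β ≤ ε * x + C := by
  set B : ℝ := ε ^ (1 / (β - 1)) with hB
  have hB0 : 0 < B := Real.rpow_pos_of_pos hε _
  refine ⟨B ^ β, by positivity, fun x hx => ?_⟩
  rcases le_total x B with h | h
  · have := Real.rpow_le_rpow hx h hβ.1.le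
    nlinarith [mul_nonneg hε.le hx]
  · have hx0 : 0 < x := hB0.trans_le h
    have h1 : x ^ (β - 1) ≤ ε := by
      calc x ^ (β - 1) ≤ B ^ (β - 1) :=
            Real.rpow_le_rpow_of_nonpos hB0 h (by linarith [hβ.2])
        _ = ε := by
            rw [hB, ← Real.rpow_mul hε.le, one_div_mul_cancel (by linarith [hβ.2]), Real.rpow_one]
    have h2 : x ^ β = x ^ (β - 1) * x := by
      rw [← Real.rpow_add_one hx0.ne', sub_add_cancel]
    rw [h2]
    have : 0 ≤ B ^ β := by positivity
    nlinarith

/-! ### Pathwise bounds on mass and profit. -/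

section Space

variable {D : Type*} [MeasurableSpace D] {μ : Measure D} {p p' : ℝ≥0∞} [Fact (1 ≤ p)]
  {S : ℝ≥0 → Lp ℝ p μ →L[ℝ] Lp ℝ p μ}

theorem IsPolarDecomposition.sigmaFinite {n : ℝ≥0 → Lp ℝ p μ} {m : Measure ℝ≥0}
    {ρ : ℝ≥0 → Lp ℝ p μ} (h : IsPolarDecomposition n m ρ) : SigmaFinite m :=
  ⟨⟨{ set := fun k : ℕ => Set.Iic (k : ℝ≥0)
      set_mem := fun _ => trivial
      finite := fun _ => h.lt_top _
      spanning := Set.eq_univ_of_forall fun x =>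
        let ⟨k, hk⟩ := exists_nat_ge x
        Set.mem_iUnion.2 ⟨k, hk⟩ }⟩⟩

instance : IsOrderedModule ℝ (Lp ℝ p μ) :=
  .of_smul_nonneg fun a ha f hf => by
    rw [← Lp.coeFn_nonneg] at hf ⊢
    filter_upwards [hf, Lp.coeFn_smul a f] with x hx hx'
    rw [hx']
    exact mul_nonneg ha hx

theorem mildSolution_nonneg (hS : IsPositivityPreserving S) {y : Lp ℝ p μ} (hy : 0 ≤ y)
    {n : ℝ≥0 → Lp ℝ p μ} (h : HasPolarDecomposition n) (t : ℝ≥0) : 0 ≤ mildSolution S y n t :=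
  add_nonneg (hS t y hy) (integral_nonneg fun s =>
    hS _ _ ((isPolarDecomposition_of_hasPolarDecomposition h).nonneg s))

variable [IsFiniteMeasure μ]

theorem integral_rpow_le {β ε C : ℝ} (hC : ∀ x : ℝ, 0 ≤ x → x ^ β ≤ ε * x + C) {k : Lp ℝ p μ}
    (hk : 0 ≤ k) : ∫ x, k x ^ β ∂μ ≤ ε * ∫ x, k x ∂μ + C * μ.real Set.univ := by
  have hk' := (Lp.coeFn_nonneg k).2 hk
  have hi := integrable_Lp k
  calc ∫ x, k x ^ β ∂μ ≤ ∫ x, (ε * k x + C) ∂μ := by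
        refine integral_mono_of_nonneg ?_ ((hi.const_mul ε).add (integrable_const C)) ?_
        · filter_upwards [hk'] with x hx using Real.rpow_nonneg hx _
        · filter_upwards [hk'] with x hx using hC _ hx
    _ = _ := by
        rw [integral_add (hi.const_mul ε) (integrable_const C), integral_const_mul, integral_const,
          smul_eq_mul, mul_comm C]

/-- The total mass `⟨1, dn⟩` of the `L^p`-valued measure `dn = ρ dm`. -/
def massMeasure (m : Measure ℝ≥0) (ρ : ℝ≥0 → Lp ℝ p μ) : Measure ℝ≥0 :=
  m.withDensity fun s => ENNReal.ofReal (∫ x, ρ s x ∂μ)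

theorem IsPolarDecomposition.measurable_mass {n : ℝ≥0 → Lp ℝ p μ} {m : Measure ℝ≥0}
    {ρ : ℝ≥0 → Lp ℝ p μ} (h : IsPolarDecomposition n m ρ) :
    Measurable fun s => ENNReal.ofReal (∫ x, ρ s x ∂μ) := by
  simp_rw [← integralLp_apply]
  exact (((integralLp μ p).continuous.comp_stronglyMeasurable
    h.stronglyMeasurable).measurable).ennreal_ofReal

/-- This identifies the distribution function of the mass as `⟨1, n_t⟩`, an adapted process when `n`
is a path of a control, as the change of time requires. -/
theorem IsPolarDecomposition.massMeasure_Iic {n : ℝ≥0 → Lp ℝ p μ} {m : Measure ℝ≥0}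
    {ρ : ℝ≥0 → Lp ℝ p μ} (h : IsPolarDecomposition n m ρ) (t : ℝ≥0) :
    massMeasure m ρ (Set.Iic t) = ENNReal.ofReal (∫ x, n t x ∂μ) := by
  rw [massMeasure, withDensity_apply _ measurableSet_Iic, ← integralLp_apply, h.eq_integral,
    ← (integralLp μ p).integral_comp_comm (h.integrableOn t),
    ofReal_integral_eq_lintegral_ofReal]
  · simp_rw [integralLp_apply]
  · exact (integralLp μ p).integrable_comp (h.integrableOn t)
  · refine .of_forall fun s => ?_
    simp only [Pi.zero_apply, integralLp_apply]
    exact integral_Lp_nonneg (h.nonneg s)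

theorem IsPolarDecomposition.lintegral_massMeasure {n : ℝ≥0 → Lp ℝ p μ} {m : Measure ℝ≥0}
    {ρ : ℝ≥0 → Lp ℝ p μ} (h : IsPolarDecomposition n m ρ) (f : ℝ≥0 → ℝ≥0∞) {s : Set ℝ≥0}
    (hs : MeasurableSet s) : ∫⁻ t in s, f t ∂(massMeasure m ρ) =
      ∫⁻ t in s, ENNReal.ofReal (∫ x, ρ t x ∂μ) * f t ∂m :=
  setLIntegral_withDensity_eq_setLIntegral_mul_non_measurable _ h.measurable_mass _ hs
    (.of_forall fun _ => ENNReal.ofReal_lt_top)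

theorem costIntegral_homogeneousCost {Ω : Type*} {r : ℝ} {φ : ℝ≥0 → Ω → ℝ} {ω : Ω}
    {n : ℝ≥0 → Lp ℝ p μ} (h : HasPolarDecomposition n) :
    costIntegral (fun t => homogeneousCost p' μ r φ t ω) n =
      ∫⁻ t, ENNReal.ofReal (Real.exp (-r * t) * φ t ω)
        ∂(massMeasure (variationMeasure n) (polarDensity n)) := by
  have hp := isPolarDecomposition_of_hasPolarDecomposition h
  rw [← setLIntegral_univ, hp.lintegral_massMeasure _ MeasurableSet.univ, setLIntegral_univ]
  refine lintegral_congr fun t => ?_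
  simp only [homogeneousCost]
  rw [pairing_smul_left, pairing_const, one_mul, mul_comm,
    ENNReal.ofReal_mul (integral_Lp_nonneg (hp.nonneg t))]

theorem ofReal_integral_mildSolution_le {c : ℝ}
    (hS : ∀ t v, ∫ x, S t v x ∂μ = Real.exp (c * t) * ∫ x, v x ∂μ) {y : Lp ℝ p μ}
    {n : ℝ≥0 → Lp ℝ p μ} (h : HasPolarDecomposition n) (t : ℝ≥0) :
    ENNReal.ofReal (∫ x, mildSolution S y n t x ∂μ) ≤
      ENNReal.ofReal (Real.exp (c * t) * ∫ x, y x ∂μ) +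
        ∫⁻ s in Set.Iic t, ENNReal.ofReal (Real.exp (c * (t - s)))
          ∂(massMeasure (variationMeasure n) (polarDensity n)) := by
  have hp := isPolarDecomposition_of_hasPolarDecomposition h
  rw [← integralLp_apply, mildSolution, map_add, integralLp_apply, hS]
  refine ENNReal.ofReal_add_le.trans (add_le_add le_rfl ?_)
  rw [hp.lintegral_massMeasure _ measurableSet_Iic]
  by_cases hi : IntegrableOn (fun s => S (t - s) (polarDensity n s)) (Set.Iic t)
      (variationMeasure n)
  · rw [← (integralLp μ p).integral_comp_comm hi, ofReal_integral_eq_lintegral_ofReal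
      ((integralLp μ p).integrable_comp hi) (.of_forall fun s => ?_)]
    swap
    · simp only [Pi.zero_apply, integralLp_apply, hS]
      exact mul_nonneg (Real.exp_nonneg _) (integral_Lp_nonneg (hp.nonneg s))
    refine setLIntegral_mono' measurableSet_Iic fun s hs => le_of_eq ?_
    rw [integralLp_apply, hS, mul_comm, ENNReal.ofReal_mul (integral_Lp_nonneg (hp.nonneg s)),
      NNReal.coe_sub hs]
  -- A non-integrable integrand makes the Bochner integral `0`, and the bound is trivial.
  · rw [integral_undef hi]
    simp

/-- The pathwise bound of the discounted profit by a constant and the tail integrals of `z ^ α`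
along the control. -/
theorem lintegral_powerProfit_le {Ω : Type*} {c r α ε C : ℝ} (hε : 0 ≤ ε) (hC0 : 0 ≤ C)
    (hα : α < 1) (hC : ∀ x : ℝ, 0 ≤ x → x ^ (1 - α) ≤ ε * x + C)
    (hSpos : IsPositivityPreserving S)
    (hS : ∀ t v, ∫ x, S t v x ∂μ = Real.exp (c * t) * ∫ x, v x ∂μ)
    {z : ℝ≥0 → Ω → ℝ} {ω : Ω} (hz : ∀ t, 0 ≤ z t ω) (hzm : Measurable fun t => z t ω)
    {y : Lp ℝ p μ} (hy : 0 ≤ y) {n : ℝ≥0 → Lp ℝ p μ} (h : HasPolarDecomposition n) :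
    ∫⁻ t, ENNReal.ofReal (powerProfit α z t ω (mildSolution S y n t)) ∂(discountMeasure r) ≤
      ENNReal.ofReal ((1 - α)⁻¹ * (C * μ.real Set.univ + ε * ∫ x, y x ∂μ)) *
        ∫⁻ t : ℝ≥0, ENNReal.ofReal (Real.exp (-(min r (r - c)) * t) * z t ω ^ α) ∂lebesgue +
      ENNReal.ofReal ((1 - α)⁻¹ * ε) *
        ∫⁻ s : ℝ≥0, ENNReal.ofReal (Real.exp (-c * s)) * ∫⁻ t in Set.Ici s,
          ENNReal.ofReal (Real.exp (-(r - c) * t) * z t ω ^ α) ∂lebesgue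
            ∂(massMeasure (variationMeasure n) (polarDensity n)) := by
  have hp := isPolarDecomposition_of_hasPolarDecomposition h
  have hα' : 0 < (1 - α)⁻¹ := inv_pos.2 (by linarith)
  have hy' : 0 ≤ ∫ x, y x ∂μ := integral_Lp_nonneg hy
  have := hp.sigmaFinite
  set M := massMeasure (variationMeasure n) (polarDensity n) with hM
  have : SFinite M := by
    rw [hM, massMeasure]
    infer_instance
  have hexp : Measurable fun t : ℝ≥0 => ENNReal.ofReal (Real.exp (-r * t)) := by fun_prop
  rw [discountMeasure, lintegral_withDensity_eq_lintegral_mul_non_measurable _ hexp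
    (.of_forall fun _ => ENNReal.ofReal_lt_top)]
  have hz' : ∀ t, 0 ≤ z t ω ^ α := fun t => Real.rpow_nonneg (hz t) _
  have hzm' : Measurable fun t => z t ω ^ α := hzm.pow_const α
  have ham : Measurable fun t : ℝ≥0 => ENNReal.ofReal (Real.exp (-r * t) * z t ω ^ α) := by
    fun_prop
  have hbm : Measurable (Function.uncurry fun t s : ℝ≥0 =>
      ENNReal.ofReal (Real.exp (c * (t - s)))) := by
    unfold Function.uncurry
    fun_prop
  have hwm : Measurable fun t : ℝ≥0 =>
      ENNReal.ofReal (Real.exp (-(min r (r - c)) * t) * z t ω ^ α) := by fun_prop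
  have hswap : ∫⁻ s : ℝ≥0, ENNReal.ofReal (Real.exp (-c * s)) * ∫⁻ t in Set.Ici s,
        ENNReal.ofReal (Real.exp (-(r - c) * t) * z t ω ^ α) ∂lebesgue ∂M =
      ∫⁻ t : ℝ≥0, ENNReal.ofReal (Real.exp (-r * t) * z t ω ^ α) *
        ∫⁻ s in Set.Iic t, ENNReal.ofReal (Real.exp (c * (t - s))) ∂M ∂lebesgue := by
    rw [lintegral_lintegral_Iic ham hbm]
    refine lintegral_congr fun s => ?_
    rw [← lintegral_const_mul _ (by fun_prop)]
    refine lintegral_congr fun t => ?_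
    rw [← ENNReal.ofReal_mul (Real.exp_nonneg _),
      ← ENNReal.ofReal_mul (mul_nonneg (Real.exp_nonneg _) (hz' t)), ← mul_assoc, ← Real.exp_add,
      mul_right_comm, ← Real.exp_add]
    ring_nf
  rw [hswap, ← lintegral_const_mul _ hwm, ← lintegral_const_mul' _ _ ENNReal.ofReal_ne_top,
    ← lintegral_add_left (hwm.const_mul _)]
  refine lintegral_mono fun t => ?_
  simp only [Pi.mul_apply]
  set Y := mildSolution S y n t with hY
  set I := ∫⁻ s in Set.Iic t, ENNReal.ofReal (Real.exp (c * (t - s))) ∂M with hI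
  set q := Real.exp (-r * t) * z t ω ^ α with hq
  have hq0 : 0 ≤ q := mul_nonneg (Real.exp_nonneg _) (hz' t)
  have hY1 : ∫ x, Y x ^ (1 - α) ∂μ ≤ ε * ∫ x, Y x ∂μ + C * μ.real Set.univ :=
    integral_rpow_le hC (mildSolution_nonneg hSpos hy h t)
  have hY2 : ENNReal.ofReal (∫ x, Y x ∂μ) ≤
      ENNReal.ofReal (Real.exp (c * t) * ∫ x, y x ∂μ) + I :=
    ofReal_integral_mildSolution_le hS h t
  have ht : (0 : ℝ) ≤ t := t.2
  -- The rate `min r (r - c)` serves both the constant term, discounted at rate `r`, and the initial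
  -- state, whose mass grows like `e^{ct}`.
  have he1 : Real.exp (-r * t) ≤ Real.exp (-(min r (r - c)) * t) :=
    Real.exp_le_exp.2 (by nlinarith [min_le_left r (r - c)])
  have he2 : Real.exp (-r * t) * Real.exp (c * t) ≤ Real.exp (-(min r (r - c)) * t) := by
    rw [← Real.exp_add]
    exact Real.exp_le_exp.2 (by nlinarith [min_le_right r (r - c)])
  calc ENNReal.ofReal (Real.exp (-r * t)) * ENNReal.ofReal (powerProfit α z t ω Y)
      = ENNReal.ofReal ((1 - α)⁻¹ * q * ∫ x, Y x ^ (1 - α) ∂μ) := by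
        rw [← ENNReal.ofReal_mul (Real.exp_nonneg _), powerProfit, hq]
        ring_nf
    _ ≤ ENNReal.ofReal ((1 - α)⁻¹ * q * (C * μ.real Set.univ) +
          (1 - α)⁻¹ * ε * q * ∫ x, Y x ∂μ) := by
        refine ENNReal.ofReal_le_ofReal ?_
        have := mul_le_mul_of_nonneg_left hY1 (mul_nonneg hα'.le hq0)
        linarith
    _ ≤ ENNReal.ofReal ((1 - α)⁻¹ * q * (C * μ.real Set.univ)) +
          ENNReal.ofReal ((1 - α)⁻¹ * ε * q) *
            (ENNReal.ofReal (Real.exp (c * t) * ∫ x, y x ∂μ) + I) := by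
        refine ENNReal.ofReal_add_le.trans (add_le_add le_rfl ?_)
        rw [ENNReal.ofReal_mul (by positivity)]
        gcongr
    _ = ENNReal.ofReal ((1 - α)⁻¹ * q * (C * μ.real Set.univ) +
          (1 - α)⁻¹ * ε * q * (Real.exp (c * t) * ∫ x, y x ∂μ)) +
          ENNReal.ofReal ((1 - α)⁻¹ * ε) * (ENNReal.ofReal q * I) := by
        rw [mul_add, ← add_assoc, ← ENNReal.ofReal_mul (by positivity),
          ← ENNReal.ofReal_add (by positivity) (by positivity),
          ENNReal.ofReal_mul (q := q) (by positivity), mul_assoc (ENNReal.ofReal _)]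
    _ ≤ _ := by
        refine add_le_add ?_ le_rfl
        rw [← ENNReal.ofReal_mul (by positivity)]
        refine ENNReal.ofReal_le_ofReal ?_
        have h1 := mul_le_mul_of_nonneg_right he1
          (show 0 ≤ (1 - α)⁻¹ * z t ω ^ α * (C * μ.real Set.univ) by have := hz' t; positivity)
        have h2 := mul_le_mul_of_nonneg_right he2
          (show 0 ≤ (1 - α)⁻¹ * ε * z t ω ^ α * ∫ x, y x ∂μ by have := hz' t; positivity)
        rw [hq]
        linarith

end Space

/-- The conditional domination of tail integrals, in integrated form. -/
theorem setLIntegral_tail_le {Ω : Type*} {𝒢 mΩ : MeasurableSpace Ω} {P : Measure Ω}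
    [IsFiniteMeasure P] (h𝒢 : 𝒢 ≤ mΩ) {g : ℝ≥0 → Ω → ℝ}
    (hg : Measurable (Function.uncurry g)) (hg_nonneg : ∀ᵐ ω ∂P, ∀ t, 0 ≤ g t ω)
    (hfin : ∫⁻ ω, ∫⁻ t, ENNReal.ofReal (g t ω) ∂lebesgue ∂P ≠ ∞) (s : ℝ≥0) {b : Ω → ℝ}
    (hb : P[fun ω => ∫ t in Set.Ici s, g t ω ∂lebesgue | 𝒢] ≤ᵐ[P] b) {E : Set Ω}
    (hE : MeasurableSet[𝒢] E) :
    ∫⁻ ω in E, ∫⁻ t in Set.Ici s, ENNReal.ofReal (g t ω) ∂lebesgue ∂P ≤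
      ∫⁻ ω in E, ENNReal.ofReal (b ω) ∂P := by
  set W : Ω → ℝ≥0∞ := fun ω => ∫⁻ t in Set.Ici s, ENNReal.ofReal (g t ω) ∂lebesgue with hW
  have hWm : Measurable W :=
    (measurable_lintegral_Ici (w := fun t ω => ENNReal.ofReal (g t ω))
      hg.ennreal_ofReal).comp measurable_prodMk_left
  have hWfin : ∫⁻ ω, W ω ∂P ≠ ∞ :=
    ne_top_of_le_ne_top hfin (lintegral_mono fun ω => setLIntegral_le_lintegral _ _)
  -- Integrability ensures that the conditional expectation is not the default value `0` and
  -- preserves integrals over `𝒢`-measurable sets.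
  have hWint : Integrable (fun ω => (W ω).toReal) P :=
    integrable_toReal_of_lintegral_ne_top hWm.aemeasurable hWfin
  have hZ : (fun ω => ∫ t in Set.Ici s, g t ω ∂lebesgue) =ᵐ[P] fun ω => (W ω).toReal := by
    filter_upwards [hg_nonneg] with ω hω
    exact integral_eq_lintegral_of_nonneg_ae (.of_forall hω)
      (hg.comp measurable_prodMk_right).aestronglyMeasurable
  have hcond : P[fun ω => (W ω).toReal | 𝒢] ≤ᵐ[P] b := (condExp_congr_ae hZ).symm.trans_le hb
  have hcond0 : 0 ≤ᵐ[P] P[fun ω => (W ω).toReal | 𝒢] :=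
    condExp_nonneg (.of_forall fun ω => ENNReal.toReal_nonneg)
  calc ∫⁻ ω in E, W ω ∂P = ∫⁻ ω in E, ENNReal.ofReal (W ω).toReal ∂P := by
        refine lintegral_congr_ae (ae_restrict_of_ae ?_)
        filter_upwards [ae_lt_top hWm hWfin] with ω hω
        rw [ENNReal.ofReal_toReal hω.ne]
    _ = ENNReal.ofReal (∫ ω in E, (W ω).toReal ∂P) :=
        (ofReal_integral_eq_lintegral_ofReal hWint.restrict
          (.of_forall fun ω => ENNReal.toReal_nonneg)).symm
    _ = ENNReal.ofReal (∫ ω in E, (P[fun ω => (W ω).toReal | 𝒢]) ω ∂P) := by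
        rw [setIntegral_condExp h𝒢 hWint hE]
    _ = ∫⁻ ω in E, ENNReal.ofReal ((P[fun ω => (W ω).toReal | 𝒢]) ω) ∂P :=
        ofReal_integral_eq_lintegral_ofReal integrable_condExp.restrict (ae_restrict_of_ae hcond0)
    _ ≤ _ := by
        refine lintegral_mono_ae (ae_restrict_of_ae ?_)
        filter_upwards [hcond] with ω hω using ENNReal.ofReal_le_ofReal hω

end SingularControl

end

/-! ### The linear growth bound. -/

open SingularControl in
theorem lemma4p5
    -- the finite measure space `D` and the spaces `X = L^p`, `X* = L^{p'}`
    {D : Type*} [MeasurableSpace D] (μ : Measure D) [IsFiniteMeasure μ]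
    (p p' : ℝ≥0∞) [Fact (1 ≤ p)] [ENNReal.HolderConjugate p p'] (hp_one : 1 < p) (hp_top : p < ∞)
    -- the filtered probability space
    {Ω : Type*} {mΩ : MeasurableSpace Ω} (P : Measure Ω) [IsProbabilityMeasure P]
    (ℱ : Filtration ℝ≥0 mΩ)
    -- the operator `A` and the positivity-preserving semigroup it generates
    (A : Lp ℝ p μ →ₗ.[ℝ] Lp ℝ p μ) (S : ℝ≥0 → Lp ℝ p μ →L[ℝ] Lp ℝ p μ)
    (hA_closed : A.IsClosed) (hA_dense : Dense (A.domain : Set (Lp ℝ p μ)))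
    (hS : SingularControl.IsC0Semigroup S) (hS_pos : SingularControl.IsPositivityPreserving S)
    (hAS : SingularControl.IsGenerator A S)
    -- `1` is an eigenvector of `A` and of `A*`
    (eig eigAdj : ℝ)
    (h_eig : (Lp.const p μ (1 : ℝ), eig • Lp.const p μ (1 : ℝ)) ∈ A.graph)
    (h_eigAdj : SingularControl.IsAdjointPair A (Lp.const p' μ (1 : ℝ))
      (eigAdj • Lp.const p' μ (1 : ℝ)))
    -- the parameters, the profit process `z` and the cost process `φ`
    (r α : ℝ) (hr : max eigAdj 0 < r) (hα : α ∈ Set.Ioo (0 : ℝ) 1)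
    (z φ : ℝ≥0 → Ω → ℝ)
    (hz : IsProgressive ℱ z) (hz_nonneg : ∀ᵐ ω ∂P, ∀ t, 0 ≤ z t ω)
    (hφ : IsProgressive ℱ φ) (hφ_nonneg : ∀ᵐ ω ∂P, ∀ t, 0 ≤ φ t ω)
    (hφ_cadlag : ∀ᵐ ω ∂P, SingularControl.IsCadlag fun t => φ t ω)
    -- the two integrability conditions
    (h_integr : ∫⁻ ω, ∫⁻ t : ℝ≥0,
      ENNReal.ofReal (Real.exp (-(min r (r - eigAdj)) * t) * z t ω ^ α)
        ∂SingularControl.lebesgue ∂P < ∞)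
    (h_cond : ∃ m : ℝ, 0 < m ∧ ∀ s : ℝ≥0,
      P[fun ω => ∫ t in Set.Ici s, Real.exp (-(r - eigAdj) * t) * z t ω ^ α
          ∂SingularControl.lebesgue | ℱ s]
        ≤ᵐ[P] fun ω => m * (Real.exp (-(r - eigAdj) * s) * φ s ω)) :
    ∃ C : ℝ, 0 < C ∧ ∀ y : Lp ℝ p μ, 0 ≤ y →
      SingularControl.valueFunction P ℱ S (SingularControl.discountMeasure r)
          (SingularControl.powerProfit α z) (SingularControl.homogeneousCost p' μ r φ) y
        ≤ ((C * (1 + SingularControl.pairing (Lp.const p' μ (1 : ℝ)) y) : ℝ) : EReal) := by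
  obtain ⟨m, hm, hcond⟩ := h_cond
  set K : ℝ≥0∞ := ∫⁻ ω, ∫⁻ t : ℝ≥0,
    ENNReal.ofReal (Real.exp (-(min r (r - eigAdj)) * t) * z t ω ^ α) ∂lebesgue ∂P with hK
  have hα1 : 0 < 1 - α := by linarith [hα.2]
  -- With this `ε`, `(1 - α)⁻¹ * ε * m = 1`, so the dominated term is exactly the cost.
  obtain ⟨C, hC0, hC⟩ := exists_rpow_le_mul_add (β := 1 - α) (ε := (1 - α) / m)
    ⟨hα1, by linarith [hα.1]⟩ (by positivity)
  have hSint := integral_semigroup (p' := p') hS hAS hA_dense h_eigAdj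
  have hzm := measurable_uncurry_of_isProgressive hz
  let g : ℝ≥0 → Ω → ℝ := fun t ω => Real.exp (-(r - eigAdj) * t) * z t ω ^ α
  have hgm : Measurable (Function.uncurry g) :=
    Measurable.mul (by fun_prop) (hzm.pow_const α)
  have hg_nonneg : ∀ᵐ ω ∂P, ∀ t, 0 ≤ g t ω := by
    filter_upwards [hz_nonneg] with ω hω t
    exact mul_nonneg (Real.exp_nonneg _) (Real.rpow_nonneg (hω t) _)
  have hg_fin : ∫⁻ ω, ∫⁻ t, ENNReal.ofReal (g t ω) ∂lebesgue ∂P ≠ ∞ := by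
    refine ne_top_of_le_ne_top h_integr.ne (lintegral_mono_ae ?_)
    filter_upwards [hz_nonneg] with ω hω
    refine lintegral_mono fun t => ENNReal.ofReal_le_ofReal
      (mul_le_mul_of_nonneg_right (Real.exp_le_exp.2 ?_) (Real.rpow_nonneg (hω t) _))
    exact mul_le_mul_of_nonneg_right (neg_le_neg (min_le_right _ _)) t.2
  let W : ℝ≥0 → Ω → ℝ≥0∞ := fun s ω => ∫⁻ t in Set.Ici s, ENNReal.ofReal (g t ω) ∂lebesgue
  have hWm : Measurable (Function.uncurry W) :=
    measurable_lintegral_Ici (w := fun t ω => ENNReal.ofReal (g t ω)) hgm.ennreal_ofReal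
  have hg_fin' : ∀ᵐ ω ∂P, ∫⁻ t, ENNReal.ofReal (g t ω) ∂lebesgue ≠ ∞ := by
    filter_upwards [ae_lt_top (hgm.ennreal_ofReal.lintegral_prod_left (μ := lebesgue)) hg_fin]
      with ω hω using hω.ne
  let ζ : ℝ≥0 → Ω → ℝ≥0∞ := fun s ω => ENNReal.ofReal (Real.exp (-eigAdj * s)) * W s ω
  let ψ : ℝ≥0 → Ω → ℝ≥0∞ := fun s ω => ENNReal.ofReal (m * (Real.exp (-r * s) * φ s ω))
  have hζm : Measurable (Function.uncurry ζ) := Measurable.mul (by fun_prop) hWm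
  have hexp : Measurable fun t : ℝ≥0 => Real.exp (-r * t) := by fun_prop
  have hψ : IsProgressive ℱ ψ := fun t =>
    Measurable.ennreal_ofReal (Measurable.const_mul (Measurable.mul
      ((hexp.comp measurable_subtype_coe).comp measurable_fst) (hφ t)) m)
  have hle : ∀ s E, MeasurableSet[ℱ s] E →
      ∫⁻ ω in E, ζ s ω ∂P ≤ ∫⁻ ω in E, ψ s ω ∂P := fun s E hE => by
    have := setLIntegral_tail_le (ℱ.le s) hgm hg_nonneg hg_fin s (hcond s) hE
    simp only [ζ, ψ]
    rw [lintegral_const_mul' _ _ ENNReal.ofReal_ne_top]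
    refine (mul_le_mul_right this _).trans (le_of_eq ?_)
    rw [← lintegral_const_mul' _ _ ENNReal.ofReal_ne_top]
    refine lintegral_congr fun ω => ?_
    rw [← ENNReal.ofReal_mul (Real.exp_nonneg _), mul_left_comm, ← mul_assoc (Real.exp _),
      ← Real.exp_add]
    ring_nf
  have hζ_cont : ∀ᵐ ω ∂P, ∀ t, ContinuousWithinAt (fun s => ζ s ω) (Set.Ici t) t := by
    filter_upwards [hg_fin'] with ω hω t
    refine ContinuousAt.continuousWithinAt (ENNReal.Tendsto.mul
      ((ENNReal.continuous_ofReal.comp (by fun_prop)).tendsto t) (.inr ?_)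
      ((continuous_lintegral_Ici (hgm.comp measurable_prodMk_right).ennreal_ofReal hω).tendsto t)
      (.inr ENNReal.ofReal_ne_top))
    exact ne_top_of_le_ne_top hω (setLIntegral_le_lintegral _ _)
  have hψ_cont : ∀ᵐ ω ∂P, ∀ t, ContinuousWithinAt (fun s => ψ s ω) (Set.Ici t) t := by
    filter_upwards [hφ_cadlag] with ω hω t
    refine ENNReal.continuous_ofReal.continuousAt.comp_continuousWithinAt
      (continuousWithinAt_const.mul (ContinuousWithinAt.mul ?_ (hω t).1))
    exact Continuous.continuousWithinAt (by fun_prop)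
  -- `B` collects the coefficients of `1` and of `⟨1, y⟩`. It can vanish, for instance if `K = 0`,
  -- hence the constant `B + 1`.
  set B : ℝ := (1 - α)⁻¹ * (C * μ.real Set.univ + (1 - α) / m) * K.toReal with hB
  refine ⟨B + 1, by positivity, fun y hy => ?_⟩
  rw [pairing_const, one_mul]
  have hy' : 0 ≤ ∫ x, y x ∂μ := integral_Lp_nonneg hy
  refine iSup₂_le fun ν hν => ?_
  set M : Ω → Measure ℝ≥0 := fun ω =>
    massMeasure (variationMeasure fun t => ν t ω) (polarDensity fun t => ν t ω) with hM
  have hcost : ∫⁻ ω, costIntegral (fun t => homogeneousCost p' μ r φ t ω) (fun t => ν t ω) ∂P =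
      ∫⁻ ω, ∫⁻ t, ENNReal.ofReal (Real.exp (-r * t) * φ t ω) ∂(M ω) ∂P := by
    refine lintegral_congr_ae ?_
    filter_upwards [hν.hasPolarDecomposition] with ω hω
    exact costIntegral_homogeneousCost hω
  have hdom : ∫⁻ ω, ∫⁻ s, ζ s ω ∂(M ω) ∂P ≤ ∫⁻ ω, ∫⁻ s, ψ s ω ∂(M ω) ∂P := by
    refine lintegral_lintegral_le (N := fun t ω => ∫ x, ν t ω x ∂μ) hζm hψ hle hζ_cont hψ_cont
      (.of_forall fun ω t => ENNReal.ofReal_ne_top) (fun t => ?_) ?_ ?_ ?_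
    · simp_rw [← integralLp_apply]
      exact ((integralLp μ p).continuous.comp_stronglyMeasurable
        (hν.isControl.adapted t)).measurable
    · filter_upwards [hν.isControl.monotone] with ω hω s t hst
      exact integral_mono_ae (integrable_Lp _) (integrable_Lp _) ((Lp.coeFn_le _ _).2 (hω hst))
    · filter_upwards [hν.isControl.rightContinuous] with ω hω t
      simp_rw [← integralLp_apply]
      exact (integralLp μ p).continuous.continuousAt.comp_continuousWithinAt (hω t)
    · filter_upwards [hν.hasPolarDecomposition] with ω hω t
      exact (isPolarDecomposition_of_hasPolarDecomposition hω).massMeasure_Iic t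
  have hprofit : ∫⁻ ω, ∫⁻ t, ENNReal.ofReal (powerProfit α z t ω
      (mildSolution S y (fun u => ν u ω) t)) ∂(discountMeasure r) ∂P ≤
      ENNReal.ofReal ((B + 1) * (1 + ∫ x, y x ∂μ)) +
        ∫⁻ ω, costIntegral (fun t => homogeneousCost p' μ r φ t ω) (fun t => ν t ω) ∂P := by
    have hKm : Measurable fun ω => ∫⁻ t : ℝ≥0,
        ENNReal.ofReal (Real.exp (-(min r (r - eigAdj)) * t) * z t ω ^ α) ∂lebesgue :=
      Measurable.lintegral_prod_left (μ := lebesgue) (f := fun (t : ℝ≥0) ω =>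
        ENNReal.ofReal (Real.exp (-(min r (r - eigAdj)) * t) * z t ω ^ α))
        (Measurable.ennreal_ofReal (Measurable.mul (by fun_prop) (hzm.pow_const α)))
    calc _ ≤ ∫⁻ ω, (ENNReal.ofReal
            ((1 - α)⁻¹ * (C * μ.real Set.univ + (1 - α) / m * ∫ x, y x ∂μ)) *
            (∫⁻ t : ℝ≥0, ENNReal.ofReal (Real.exp (-(min r (r - eigAdj)) * t) * z t ω ^ α)
              ∂lebesgue) +
          ENNReal.ofReal ((1 - α)⁻¹ * ((1 - α) / m)) * ∫⁻ s, ζ s ω ∂(M ω)) ∂P := by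
          refine lintegral_mono_ae ?_
          filter_upwards [hz_nonneg, hν.hasPolarDecomposition] with ω hω hpol
          exact lintegral_powerProfit_le (by positivity) hC0 hα.2 hC hS_pos hSint hω
            (hzm.comp measurable_prodMk_right) hy hpol
      _ = ENNReal.ofReal ((1 - α)⁻¹ * (C * μ.real Set.univ + (1 - α) / m * ∫ x, y x ∂μ)) * K +
          ENNReal.ofReal ((1 - α)⁻¹ * ((1 - α) / m)) * ∫⁻ ω, ∫⁻ s, ζ s ω ∂(M ω) ∂P := by
          rw [lintegral_add_left (hKm.const_mul _), lintegral_const_mul _ hKm,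
            lintegral_const_mul' _ _ ENNReal.ofReal_ne_top]
      _ ≤ _ := by
          refine add_le_add ?_ ?_
          · rw [← ENNReal.ofReal_toReal h_integr.ne, ← ENNReal.ofReal_mul (by positivity)]
            refine ENNReal.ofReal_le_ofReal ?_
            have h1 : 0 ≤ (1 - α)⁻¹ * (C * μ.real Set.univ) * K.toReal := by positivity
            have h2 : 0 ≤ (1 - α)⁻¹ * ((1 - α) / m) * K.toReal := by positivity
            have h3 := mul_nonneg h1 hy'
            rw [hB]
            linarith
          · refine (mul_le_mul_right hdom _).trans (le_of_eq ?_)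
            rw [hcost, ← lintegral_const_mul' _ _ ENNReal.ofReal_ne_top]
            refine lintegral_congr fun ω => ?_
            rw [← lintegral_const_mul' _ _ ENNReal.ofReal_ne_top]
            refine lintegral_congr fun s => ?_
            rw [← ENNReal.ofReal_mul (by positivity), ← mul_assoc,
              show (1 - α)⁻¹ * ((1 - α) / m) * m = 1 by field_simp, one_mul]
  rw [performance, EReal.sub_le_iff_le_add (.inl (by simp)) (.inr (EReal.coe_ne_bot _))]
  refine (EReal.coe_ennreal_le_coe_ennreal_iff.2 hprofit).trans (le_of_eq ?_)
  rw [EReal.coe_ennreal_add, EReal.coe_ennreal_ofReal, max_eq_left (by positivity)]
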